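/- Let $\Gamma$ be a torsionless grading monoid, i.e. a commutative, cancellative, torsion-free (additive) monoid, and let $\langle\Gamma\rangle=\{a-b : a,b\in\Gamma\}$ be its group of differences. Let $R=\bigoplus_{\alpha\in\Gamma}R_\alpha$ be a $\Gamma$-graded integral domain that is integrally closed in its fraction field. Let $H$ be the set of nonzero homogeneous elements of $R$, and let $R_H$ be the graded quotient field of $R$, graded by $\langle\Gamma\rangle$ with component $(R_H)_\gamma$ consisting of $0$ and all fractions $f/g$ with $f,g$ homogeneous, $g\neq 0$ and $\deg f-\deg g=\gamma$. A graded overring of $R$ is a ring $T$ with $R\subseteq T\subseteq R_H$ and $T=\bigoplus_{\gamma\in\langle\Gamma\rangle}\bigl(T\cap (R_H)_\gamma\bigr)$. An extension $R\subseteq T$ of graded rings is graded-mated if for every homogeneous prime ideal $P$ of $R$ with $PT\neq T$ there is exactly one homogeneous prime ideal $Q$ of $T$ with $Q\cap R=P$. The domain $R$ is gr-mated if $R\subseteq T$ is graded-mated for every graded overring $T$ of $R$. The domain $R$ is gr-Prüfer if every nonzero finitely generated homogeneous ideal of $R$ is invertible. Then $R$ is gr-Prüfer if and only if $R$ is gr-mated.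 -/

import Mathlib

open Algebra

namespace GradedDomain

section Definitions

universe u v

variable {Γ : Type v} [AddCommMonoid Γ] [DecidableEq Γ]
variable {R : Type u} [CommRing R] [IsDomain R]

/-- The multiplicative set `H` of nonzero homogeneous elements of a graded domain. -/
def nonzeroHomogeneous (𝒜 : Γ → AddSubgroup R) [GradedRing 𝒜] : Submonoid R where
  carrier := {x | x ≠ 0 ∧ SetLike.IsHomogeneousElem 𝒜 x}
  one_mem' := ⟨one_ne_zero, SetLike.isHomogeneousElem_one 𝒜⟩
  mul_mem' := fun ha hb => ⟨mul_ne_zero ha.1 hb.1, ha.2.mul hb.2⟩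

/-- The graded quotient field `R_H` of a graded domain `R` (in general not a field). -/
abbrev GradedQuotientField (𝒜 : Γ → AddSubgroup R) [GradedRing 𝒜] : Type u :=
  Localization (nonzeroHomogeneous 𝒜)

/-- The component of degree `γ ∈ ⟨Γ⟩` of the graded quotient field: zero together with all
fractions `f / g` with `f`, `g` homogeneous, `g ≠ 0` and `deg f - deg g = γ`. Here `⟨Γ⟩` is the
group of differences of the cancellative monoid `Γ`. -/
def quotientComponent [IsCancelAdd Γ] (𝒜 : Γ → AddSubgroup R) [GradedRing 𝒜]
    (γ : GrothendieckAddGroup Γ) : AddSubgroup (GradedQuotientField 𝒜) where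
  carrier := {x | x = 0 ∨ ∃ (α β : Γ) (f : R) (g : nonzeroHomogeneous 𝒜),
    f ∈ 𝒜 α ∧ (g : R) ∈ 𝒜 β ∧
      GrothendieckAddGroup.of α - GrothendieckAddGroup.of β = γ ∧ x = Localization.mk f g}
  zero_mem' := Or.inl rfl
  add_mem' := by
    rintro x y (rfl | ⟨α, β, f, g, hf, hg, hγ, rfl⟩) hy
    · rwa [zero_add]
    · rcases hy with rfl | ⟨α', β', f', g', hf', hg', hγ', rfl⟩
      · rw [add_zero]
        exact Or.inr ⟨α, β, f, g, hf, hg, hγ, rfl⟩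
      · have hdeg : β + α' = β' + α := by
          apply GrothendieckAddGroup.of_injective
          rw [map_add, map_add]
          have h := hγ.trans hγ'.symm
          rw [sub_eq_sub_iff_add_eq_add] at h
          rw [add_comm, ← h, add_comm]
        refine Or.inr ⟨β + α', β + β', (g : R) * f' + (g' : R) * f, g * g', ?_, ?_, ?_, ?_⟩
        · refine add_mem (SetLike.mul_mem_graded hg hf') ?_
          rw [hdeg]
          exact SetLike.mul_mem_graded hg' hf
        · exact SetLike.mul_mem_graded hg hg'
        · rw [map_add, map_add, add_sub_add_left_eq_sub]
          exact hγ'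
        · rw [Localization.add_mk]
  neg_mem' := by
    rintro x (rfl | ⟨α, β, f, g, hf, hg, hγ, rfl⟩)
    · exact Or.inl neg_zero
    · exact Or.inr ⟨α, β, -f, g, neg_mem hf, hg, hγ, Localization.neg_mk f g⟩

/-- For a ring `T` with `R ⊆ T ⊆ R_H`, the subgroup `T ∩ (R_H)_γ`, viewed inside `T`. -/
def overringComponent [IsCancelAdd Γ] (𝒜 : Γ → AddSubgroup R) [GradedRing 𝒜]
    (T : Subalgebra R (GradedQuotientField 𝒜)) (γ : GrothendieckAddGroup Γ) : AddSubgroup T :=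
  (quotientComponent 𝒜 γ).comap T.val.toAddMonoidHom

/-- A ring extension `R → T` of graded rings is graded-mated if for every homogeneous prime `P`
of `R` with `PT ≠ T` there is exactly one homogeneous prime `Q` of `T` with `Q ∩ R = P`. -/
def IsGradedMatedExtension {ι κ A B : Type*} [AddMonoid ι] [DecidableEq ι] [AddMonoid κ]
    [DecidableEq κ] [CommRing A] [CommRing B] [Algebra A B]
    (𝒜 : ι → AddSubgroup A) [GradedRing 𝒜] (ℬ : κ → AddSubgroup B) [GradedRing ℬ] : Prop :=
  ∀ P : Ideal A, P.IsPrime → P.IsHomogeneous 𝒜 → P.map (algebraMap A B) ≠ ⊤ →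
    ∃! Q : Ideal B, Q.IsPrime ∧ Q.IsHomogeneous ℬ ∧ Q.comap (algebraMap A B) = P

open scoped Classical in
/-- `R` is gr-mated if `R ⊆ T` is graded-mated for every graded overring `T` of `R`, that is, for
every ring `T` with `R ⊆ T ⊆ R_H` that is graded by the components `T ∩ (R_H)_γ`. -/
def IsGrMated [IsCancelAdd Γ] (𝒜 : Γ → AddSubgroup R) [GradedRing 𝒜] : Prop :=
  ∀ (T : Subalgebra R (GradedQuotientField 𝒜)) [GradedRing (overringComponent 𝒜 T)],
    IsGradedMatedExtension 𝒜 (overringComponent 𝒜 T)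

/-- `R` is gr-Prüfer if every nonzero finitely generated homogeneous ideal is invertible. -/
def IsGrPrufer (𝒜 : Γ → AddSubgroup R) [GradedRing 𝒜] : Prop :=
  ∀ I : Ideal R, I ≠ ⊥ → I.FG → I.IsHomogeneous 𝒜 →
    IsUnit (I : FractionalIdeal (nonZeroDivisors R) (FractionRing R))

end Definitions

end GradedDomain

/-! Both conditions amount to local comparability of nonzero homogeneous `f`, `g`: some `c ∉ P` has
`f ∣ c * g` or `g ∣ c * f`. An invertible `(f, g)` gives this at every prime
(`exists_notMem_dvd_of_isUnit_span_pair`). Then, if `PT ≠ T`, every element of `T` has a denominator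
outside `P`, so `T` sits in `R_P` and `P R_P ∩ T` is the only prime over `P`
(`isGrMated_of_comparable`). Conversely, if comparability fails at a homogeneous `P`, put `u = f /
g`. Integral closedness forces all relations of `u` to have coefficients in `P`
(`exists_notMem_of_aeval_eq_zero`), so `R[u]/P R[u]` is a polynomial ring over `R/P`, and `P R[u]`
and `P R[u] + u R[u]` are two homogeneous primes over `P` (`comparable_of_isGrMated`). Comparability
at homogeneous primes suffices for invertibility because the homogeneous core of a maximal ideal is
prime (`isPrime_homogeneousCore`); torsion-freeness enters only there. -/

namespace GradedDomain

universe u v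

/-! ### Unique sums and primality of homogeneous cores. -/

section TorsionFree

/-- Passing to the submonoid generated by `A ∪ B` reduces to a finitely generated cancellative
torsion-free monoid, which has unique sums. -/
theorem exists_uniqueAdd {Γ : Type v} [AddCommMonoid Γ] [IsCancelAdd Γ] [IsAddTorsionFree Γ]
    {A B : Finset Γ} (hA : A.Nonempty) (hB : B.Nonempty) :
    ∃ a ∈ A, ∃ b ∈ B, UniqueAdd A B a b := by
  classical
  let N : AddSubmonoid Γ := AddSubmonoid.closure ((A ∪ B : Finset Γ) : Set Γ)
  let _ : AddCancelCommMonoid N :=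
    { (inferInstance : AddCommMonoid N) with
      add_left_cancel := fun a _ _ h => Subtype.ext (add_left_cancel (congrArg Subtype.val h)) }
  have : AddMonoid.FG N :=
    (AddMonoid.fg_iff_addSubmonoid_fg N).2 ⟨A ∪ B, rfl⟩
  have : IsAddTorsionFree N :=
    ⟨fun n hn a b h => Subtype.ext
      (IsAddTorsionFree.nsmul_right_injective hn (by simpa using congrArg Subtype.val h))⟩
  have hAN : ∀ a ∈ A, a ∈ N := fun a ha => AddSubmonoid.subset_closure (by simp [ha])
  have hBN : ∀ b ∈ B, b ∈ N := fun b hb => AddSubmonoid.subset_closure (by simp [hb])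
  obtain ⟨a₀, ha₀⟩ := hA
  obtain ⟨b₀, hb₀⟩ := hB
  obtain ⟨a, ha, b, hb, h⟩ := UniqueSums.uniqueAdd_of_nonempty
    (A := A.subtype (· ∈ N)) (B := B.subtype (· ∈ N))
    ⟨⟨a₀, hAN _ ha₀⟩, by simpa using ha₀⟩ ⟨⟨b₀, hBN _ hb₀⟩, by simpa using hb₀⟩
  refine ⟨a, by simpa using ha, b, by simpa using hb, fun x y hx hy hxy => ?_⟩
  have := @h ⟨x, hAN _ hx⟩ ⟨y, hBN _ hy⟩ (by simpa using hx) (by simpa using hy)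
    (Subtype.ext hxy)
  exact ⟨congrArg Subtype.val this.1, congrArg Subtype.val this.2⟩

open DirectSum in
theorem isPrime_homogeneousCore {Γ : Type v} [AddCommMonoid Γ] [IsCancelAdd Γ]
    [IsAddTorsionFree Γ] [DecidableEq Γ] {R : Type u} [CommRing R]
    (𝒜 : Γ → AddSubgroup R) [GradedRing 𝒜] {M : Ideal R} (hM : M.IsPrime) :
    (M.homogeneousCore 𝒜).toIdeal.IsPrime := by
  classical
  set I := (M.homogeneousCore 𝒜).toIdeal with hI
  have hIM : I ≤ M := M.toIdeal_homogeneousCore_le 𝒜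
  have hhom : I.IsHomogeneous 𝒜 := (M.homogeneousCore 𝒜).isHomogeneous
  refine ⟨fun h => hM.ne_top (top_le_iff.1 (h ▸ hIM)), fun {x y} hxy => ?_⟩
  by_contra! ⟨hx, hy⟩
  let S : R → Finset Γ := fun x => {i ∈ (decompose 𝒜 x).support | (decompose 𝒜 x i : R) ∉ I}
  have hS : ∀ x, x ∉ I → (S x).Nonempty := by
    intro x hx
    rw [Finset.filter_nonempty_iff]
    contrapose! hx
    rw [← sum_support_decompose 𝒜 x]
    exact Ideal.sum_mem _ hx
  -- Among components outside `I`, the degree `a + b` arises only from `(a, b)`; every other term of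
  -- that component of `x * y` has a factor in `I`.
  obtain ⟨a, ha, b, hb, hab⟩ := exists_uniqueAdd (hS x hx) (hS y hy)
  have hmem : (decompose 𝒜 (x * y) (a + b) : R) ∈ I := hhom _ hxy
  have hprod : (decompose 𝒜 x a : R) * decompose 𝒜 y b ∈ I := by
    set D := {z ∈ (decompose 𝒜 x).support ×ˢ (decompose 𝒜 y).support | z.1 + z.2 = a + b}
      with hD
    have hmemD : (a, b) ∈ D := by
      simp only [D, Finset.mem_filter, Finset.mem_product, and_true]
      exact ⟨Finset.mem_of_mem_filter _ ha, Finset.mem_of_mem_filter _ hb⟩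
    have hsum : (decompose 𝒜 (x * y) (a + b) : R) =
        ∑ z ∈ D, (decompose 𝒜 x z.1 : R) * decompose 𝒜 y z.2 := by
      simp_rw [hD, decompose_mul, coe_mul_apply 𝒜]
    rw [hsum, ← Finset.add_sum_erase _ _ hmemD] at hmem
    refine (Ideal.add_mem_iff_left _ (Ideal.sum_mem _ fun z hz => ?_)).1 hmem
    obtain ⟨i, j⟩ := z
    simp only [D, Finset.mem_erase, Finset.mem_filter, Finset.mem_product, Ne, Prod.mk.injEq]
      at hz
    by_cases hi : (decompose 𝒜 x i : R) ∈ I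
    · exact I.mul_mem_right _ hi
    by_cases hj : (decompose 𝒜 y j : R) ∈ I
    · exact I.mul_mem_left _ hj
    exact (hz.1 (hab (Finset.mem_filter.2 ⟨hz.2.1.1, hi⟩)
      (Finset.mem_filter.2 ⟨hz.2.1.2, hj⟩) hz.2.2)).elim
  rcases hM.mem_or_mem (hIM hprod) with h | h
  · exact (Finset.mem_filter.1 ha).2
      (Ideal.mem_homogeneousCore_of_homogeneous_of_mem ⟨a, SetLike.coe_mem _⟩ h)
  · exact (Finset.mem_filter.1 hb).2
      (Ideal.mem_homogeneousCore_of_homogeneous_of_mem ⟨b, SetLike.coe_mem _⟩ h)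

end TorsionFree

/-! ### Homogeneous components of products. -/

section Components

open DirectSum

variable {Γ : Type v} [AddCommMonoid Γ] [DecidableEq Γ]
variable {R : Type u} [CommRing R] (𝒜 : Γ → AddSubgroup R) [GradedRing 𝒜]

theorem exists_decompose_notMem {P : Ideal R} {s : R} (hs : s ∉ P) :
    ∃ δ, (decompose 𝒜 s δ : R) ∉ P := by
  classical
  contrapose! hs
  rw [← sum_support_decompose 𝒜 s]
  exact Ideal.sum_mem _ fun i _ => hs i

variable [IsCancelAdd Γ]

theorem coe_decompose_mul_add_right {s f : R} {α : Γ} (hf : f ∈ 𝒜 α) (δ : Γ) :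
    (decompose 𝒜 (s * f) (δ + α) : R) = decompose 𝒜 s δ * f := by
  let _ : AddRightCancelMonoid Γ :=
    { (inferInstance : AddMonoid Γ) with add_right_cancel := fun a _ _ h => add_right_cancel h }
  exact coe_decompose_mul_add_of_right_mem 𝒜 hf

/-- Lets a multiplier `s` be replaced by any of its homogeneous components, since the ideal `(g)` is
homogeneous. -/
theorem dvd_decompose_mul {s f g : R} {α β : Γ} (hf : f ∈ 𝒜 α) (hg : g ∈ 𝒜 β)
    (h : g ∣ s * f) (δ : Γ) : g ∣ decompose 𝒜 s δ * f := by
  have := Ideal.homogeneous_span 𝒜 {g} (by rintro x rfl; exact ⟨β, hg⟩) (δ + α)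
    (Ideal.mem_span_singleton.2 h)
  rwa [coe_decompose_mul_add_right 𝒜 hf, Ideal.mem_span_singleton] at this

end Components

/-! ### Degrees in the graded quotient field versus degrees in `R`. -/

section QuotientField

open DirectSum

variable {Γ : Type v} [AddCommMonoid Γ] [DecidableEq Γ]
variable {R : Type u} [CommRing R] [IsDomain R] (𝒜 : Γ → AddSubgroup R) [GradedRing 𝒜]

theorem nonzeroHomogeneous_le : nonzeroHomogeneous 𝒜 ≤ nonZeroDivisors R :=
  fun _ hx => mem_nonZeroDivisors_of_ne_zero hx.1

instance : IsDomain (GradedQuotientField 𝒜) :=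
  IsLocalization.isDomain_localization (nonzeroHomogeneous_le 𝒜)

theorem algebraMap_quotientField_injective :
    Function.Injective (algebraMap R (GradedQuotientField 𝒜)) :=
  IsLocalization.injective _ (nonzeroHomogeneous_le 𝒜)

variable [IsCancelAdd Γ]

theorem algebraMap_mem_quotientComponent {r : R} {α : Γ} (hr : r ∈ 𝒜 α) :
    algebraMap R (GradedQuotientField 𝒜) r ∈
      quotientComponent 𝒜 (GrothendieckAddGroup.of α) :=
  Or.inr ⟨α, 0, r, 1, hr, SetLike.one_mem_graded 𝒜, by simp,
    (Localization.mk_one_eq_algebraMap r).symm⟩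

theorem mul_mem_quotientComponent {x y : GradedQuotientField 𝒜}
    {γ δ : GrothendieckAddGroup Γ} (hx : x ∈ quotientComponent 𝒜 γ)
    (hy : y ∈ quotientComponent 𝒜 δ) : x * y ∈ quotientComponent 𝒜 (γ + δ) := by
  rcases hx with rfl | ⟨α, β, f, g, hf, hg, rfl, rfl⟩
  · exact Or.inl (zero_mul _)
  rcases hy with rfl | ⟨α', β', f', g', hf', hg', rfl, rfl⟩
  · exact Or.inl (mul_zero _)
  refine Or.inr ⟨α + α', β + β', f * f', g * g', SetLike.mul_mem_graded hf hf',
    SetLike.mul_mem_graded hg hg', ?_, Localization.mk_mul _ _ _ _⟩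
  rw [map_add, map_add]
  abel

theorem exists_mem_of_algebraMap_mem_quotientComponent {r : R} {γ : GrothendieckAddGroup Γ}
    (hr : algebraMap R (GradedQuotientField 𝒜) r ∈ quotientComponent 𝒜 γ) (hr0 : r ≠ 0) :
    ∃ α, r ∈ 𝒜 α ∧ GrothendieckAddGroup.of α = γ := by
  classical
  rcases hr with h | ⟨α, β, f, g, hf, hg, hγ, h⟩
  · exact (hr0 (algebraMap_quotientField_injective 𝒜 (h.trans (map_zero _).symm))).elim
  have hrg : r * g = f := by
    apply algebraMap_quotientField_injective 𝒜
    rw [map_mul, h, Localization.mk_eq_mk', IsLocalization.mk'_spec]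
  -- Comparing components in `r * g = f`; cancellation then leaves only one possible `δ`.
  have key : ∀ δ, (decompose 𝒜 r δ : R) ≠ 0 → δ + β = α := by
    intro δ hδ
    by_contra hne
    have h1 := coe_decompose_mul_add_right 𝒜 (s := r) hg δ
    rw [hrg, decompose_of_mem_ne 𝒜 hf (Ne.symm hne)] at h1
    exact mul_ne_zero hδ g.2.1 h1.symm
  obtain ⟨δ, hδ⟩ := exists_decompose_notMem 𝒜 (P := ⊥) (s := r) (by simpa using hr0)
  have hδ' : (decompose 𝒜 r δ : R) ≠ 0 := by simpa using hδ
  refine ⟨δ, ?_, ?_⟩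
  · rw [← sum_support_decompose 𝒜 r]
    refine sum_mem fun i hi => ?_
    have hi' : (decompose 𝒜 r i : R) ≠ 0 := by simpa using hi
    rw [add_right_cancel ((key i hi').trans (key δ hδ').symm)]
    exact SetLike.coe_mem _
  · rw [← hγ, ← key δ hδ', map_add, add_sub_cancel_right]

theorem mem_of_sum_mem_of_isHomogeneous {ι : Type*} (s : Finset ι)
    (γ : ι → GrothendieckAddGroup Γ) (hγ : Function.Injective γ) (r : ι → R)
    (hr : ∀ i ∈ s, algebraMap R (GradedQuotientField 𝒜) (r i) ∈ quotientComponent 𝒜 (γ i))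
    {P : Ideal R} (hP : P.IsHomogeneous 𝒜) (hsum : ∑ i ∈ s, r i ∈ P) : ∀ i ∈ s, r i ∈ P := by
  intro i hi
  by_cases hi0 : r i = 0
  · rw [hi0]; exact P.zero_mem
  obtain ⟨α, hα, hαγ⟩ := exists_mem_of_algebraMap_mem_quotientComponent 𝒜 (hr i hi) hi0
  have := hP α hsum
  rw [decompose_sum, DFinsupp.finsetSum_apply, AddSubmonoidClass.coe_finsetSum,
    Finset.sum_eq_single i, decompose_of_mem_same 𝒜 hα] at this
  · exact this
  · intro j hj hji
    by_cases hj0 : r j = 0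
    · simp [hj0]
    obtain ⟨β, hβ, hβγ⟩ := exists_mem_of_algebraMap_mem_quotientComponent 𝒜 (hr j hj) hj0
    refine decompose_of_mem_ne 𝒜 hβ ?_
    rintro rfl
    exact hji (hγ (hβγ.symm.trans hαγ))
  · exact fun h => (h hi).elim

end QuotientField

/-! ### Algebraic relations over an integrally closed domain. -/

section Seidenberg

open Polynomial

/-- If `a` is the leading coefficient, `a * x` is integral, hence equals some `b` in `R`. Either `a`
or `b` is outside `P` and settles the claim, or both lie in `P` and the degree can be lowered. -/
theorem exists_notMem_of_aeval_eq_zero {R K : Type*} [CommRing R] [IsDomain R]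
    [IsIntegrallyClosed R] [Field K] [Algebra R K] [IsFractionRing R K] (P : Ideal R) (x : K)
    (n : ℕ) : ∀ p : R[X], p.natDegree ≤ n → aeval x p = 0 → (∃ i, p.coeff i ∉ P) →
    ∃ c ∉ P, ∃ r : R, algebraMap R K r = algebraMap R K c * x ∨
      algebraMap R K c = algebraMap R K r * x := by
  induction n with
  | zero =>
    rintro p hp h0 ⟨i, hi⟩
    rw [eq_C_of_natDegree_le_zero hp, aeval_C] at h0
    rw [eq_C_of_natDegree_le_zero hp, (map_eq_zero_iff _ (IsFractionRing.injective R K)).1 h0]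
      at hi
    simp at hi
  | succ n ih =>
    rintro p hp h0 ⟨i, hi⟩
    rcases hp.lt_or_eq with hlt | heq
    · exact ih p (Nat.lt_succ_iff.1 hlt) h0 ⟨i, hi⟩
    obtain ⟨b, hb⟩ := IsIntegrallyClosed.isIntegral_iff.1 (isIntegral_leadingCoeff_smul p x h0)
    rw [Algebra.smul_def] at hb
    by_cases ha : p.leadingCoeff ∈ P
    swap
    · exact ⟨_, ha, b, Or.inl hb⟩
    by_cases hbP : b ∈ P
    swap
    · exact ⟨b, hbP, p.leadingCoeff, Or.inr hb⟩
    -- Trading `a X ^ (n + 1)` for `b X ^ n` keeps the value at `x` and changes coefficients only by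
    -- elements of `P`.
    refine ih (p.eraseLead + C b * X ^ n) ?_ ?_ ⟨i, ?_⟩
    · refine natDegree_add_le_of_degree_le ?_ (natDegree_C_mul_X_pow_le _ _)
      exact (eraseLead_natDegree_le p).trans (by omega)
    · have h1 := p.eraseLead_add_C_mul_X_pow
      rw [heq] at h1
      rw [← h0]
      conv_rhs => rw [← h1]
      simp only [map_add, map_mul, aeval_C, aeval_X, map_pow, hb]
      ring
    · intro hmem
      apply hi
      by_cases hin : i = n + 1
      · rw [hin, ← heq]; exact ha
      rw [coeff_add, eraseLead_coeff_of_ne _ (heq ▸ hin), coeff_C_mul, coeff_X_pow] at hmem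
      refine (Ideal.add_mem_iff_left _ ?_).1 hmem
      exact P.mul_mem_right _ hbP

end Seidenberg

/-! ### Invertibility and local comparability. -/

section Invertible

theorem exists_notMem_dvd_of_isUnit_span_pair {R : Type u} [CommRing R] [IsDomain R] {f g : R}
    (h : IsUnit ((Ideal.span {f, g} : Ideal R) :
      FractionalIdeal (nonZeroDivisors R) (FractionRing R))) (hf : f ≠ 0)
    {P : Ideal R} (hP : P.IsPrime) : ∃ c ∉ P, f ∣ c * g ∨ g ∣ c * f := by
  have hinj := IsFractionRing.injective R (FractionRing R)
  have hI0 : ((Ideal.span {f, g} : Ideal R) :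
      FractionalIdeal (nonZeroDivisors R) (FractionRing R)) ≠ 0 := by
    rw [FractionalIdeal.coeIdeal_ne_zero]
    intro h0
    exact hf ((Submodule.eq_bot_iff _).1 h0 f (Ideal.subset_span (by simp)))
  have hmul := (FractionalIdeal.mul_inv_cancel_iff_isUnit (FractionRing R)).2 h
  set J := ((Ideal.span {f, g} : Ideal R) :
      FractionalIdeal (nonZeroDivisors R) (FractionRing R))⁻¹ with hJ
  have hint : ∀ a ∈ J, ∀ z ∈ (Ideal.span {f, g} : Ideal R),
      ∃ r : R, algebraMap R (FractionRing R) r = a * algebraMap R (FractionRing R) z := by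
    intro a ha z hz
    exact (FractionalIdeal.mem_one_iff _).1 ((FractionalIdeal.mem_inv_iff hI0).1 ha _
      (FractionalIdeal.mem_coeIdeal_of_mem _ hz))
  have hone : (1 : FractionRing R) ∈ (1 : FractionalIdeal (nonZeroDivisors R) (FractionRing R)) :=
    FractionalIdeal.one_mem_one _
  rw [← hmul, Ideal.span_insert, FractionalIdeal.coeIdeal_sup,
    add_mul, FractionalIdeal.coeIdeal_span_singleton, FractionalIdeal.coeIdeal_span_singleton,
    FractionalIdeal.mem_add] at hone
  obtain ⟨_, h1, _, h2, hsum⟩ := hone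
  obtain ⟨a, ha, rfl⟩ := FractionalIdeal.mem_singleton_mul.1 h1
  obtain ⟨b, hb, rfl⟩ := FractionalIdeal.mem_singleton_mul.1 h2
  have hfm : f ∈ (Ideal.span {f, g} : Ideal R) := Ideal.subset_span (by simp)
  have hgm : g ∈ (Ideal.span {f, g} : Ideal R) := Ideal.subset_span (by simp)
  -- With `1 = a f + b g` and `a`, `b` in the inverse ideal, `p = a f` and `s = b g` lie in `R` and
  -- sum to `1`, so one avoids `P`; `q = a g` and `r = b f` witness the divisibilities.
  obtain ⟨p, hp⟩ := hint a ha f hfm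
  obtain ⟨q, hq⟩ := hint a ha g hgm
  obtain ⟨r, hr⟩ := hint b hb f hfm
  obtain ⟨s, hs⟩ := hint b hb g hgm
  have hps : p + s = 1 := hinj (by rw [map_add, map_one, hp, hs, ← hsum]; ring)
  by_cases hpP : p ∈ P
  · have hsP : s ∉ P := fun hsP => hP.one_notMem (hps ▸ P.add_mem hpP hsP)
    exact ⟨s, hsP, Or.inr ⟨r, hinj (by rw [map_mul, map_mul, hs, hr]; ring)⟩⟩
  · exact ⟨p, hpP, Or.inl ⟨q, hinj (by rw [map_mul, map_mul, hp, hq]; ring)⟩⟩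

theorem exists_dvd_forall_of_comparable {R : Type u} [CommRing R] {P : Ideal R} (hP : P.IsPrime)
    {S : Set R} (h : ∀ f ∈ S, ∀ g ∈ S, ∃ c ∉ P, f ∣ c * g ∨ g ∣ c * f)
    (s : Finset R) (hs : (s : Set R) ⊆ S) (hne : s.Nonempty) :
    ∃ f ∈ s, ∃ c ∉ P, ∀ g ∈ s, f ∣ c * g := by
  classical
  induction hne using Finset.Nonempty.cons_induction with
  | singleton a => exact ⟨a, by simp, 1, hP.one_notMem, by simp⟩
  | cons a s ha _ ih =>
    simp only [Finset.coe_cons, Set.insert_subset_iff] at hs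
    obtain ⟨f, hf, c, hc, hcf⟩ := ih hs.2
    obtain ⟨d, hd, hdf | hda⟩ := h f (hs.2 hf) a hs.1
    · refine ⟨f, by simp [hf], c * d, hP.mul_notMem hc hd, ?_⟩
      simp only [Finset.mem_cons, forall_eq_or_imp]
      refine ⟨mul_assoc c d a ▸ hdf.mul_left c, fun g hg => ?_⟩
      rw [mul_right_comm]
      exact (hcf g hg).mul_right d
    · refine ⟨a, by simp, d * c, hP.mul_notMem hd hc, ?_⟩
      simp only [Finset.mem_cons, forall_eq_or_imp]
      refine ⟨dvd_mul_left _ _, fun g hg => ?_⟩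
      obtain ⟨k, hk⟩ := hcf g hg
      rw [mul_assoc, hk, ← mul_assoc]
      exact hda.mul_right k

open DirectSum in
/-- If homogeneous elements are pairwise comparable locally at every homogeneous prime ideal, then
nonzero finitely generated homogeneous ideals are invertible. -/
theorem isGrPrufer_of_comparable {Γ : Type v} [AddCommMonoid Γ] [IsCancelAdd Γ]
    [IsAddTorsionFree Γ] [DecidableEq Γ] {R : Type u} [CommRing R] [IsDomain R]
    (𝒜 : Γ → AddSubgroup R) [GradedRing 𝒜]
    (h : ∀ P : Ideal R, P.IsPrime → P.IsHomogeneous 𝒜 → ∀ f ∈ nonzeroHomogeneous 𝒜,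
      ∀ g ∈ nonzeroHomogeneous 𝒜, ∃ c ∉ P, f ∣ c * g ∨ g ∣ c * f) :
    IsGrPrufer 𝒜 := by
  classical
  rintro I hI0 ⟨G, hG⟩ hIhom
  rw [← FractionalIdeal.mul_inv_cancel_iff_isUnit]
  have hinj := IsFractionRing.injective R (FractionRing R)
  have hI0' : (I : FractionalIdeal (nonZeroDivisors R) (FractionRing R)) ≠ 0 :=
    FractionalIdeal.coeIdeal_ne_zero.2 hI0
  obtain ⟨J, hJ⟩ := FractionalIdeal.le_one_iff_exists_coeIdeal.1
    (FractionalIdeal.mul_one_div_le_one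
      (I := (I : FractionalIdeal (nonZeroDivisors R) (FractionRing R))))
  rw [← FractionalIdeal.inv_eq] at hJ
  rw [← hJ]
  by_contra hne
  have hJtop : J ≠ ⊤ := by
    rintro rfl
    exact hne (FractionalIdeal.coeIdeal_top _)
  -- `M` need not be homogeneous, so comparability is applied at its homogeneous core.
  obtain ⟨M, hM, hJM⟩ := J.exists_le_maximal hJtop
  have hP := isPrime_homogeneousCore 𝒜 hM.isPrime
  have hPM := M.toIdeal_homogeneousCore_le 𝒜
  have hPhom := (M.homogeneousCore 𝒜).isHomogeneous
  let s : Finset R :=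
    (G.biUnion fun x => (decompose 𝒜 x).support.image fun i => (decompose 𝒜 x i : R)).filter
      (· ≠ 0)
  have hs : (s : Set R) ⊆ nonzeroHomogeneous 𝒜 := by
    intro x hx
    simp only [s, Finset.coe_filter, Finset.mem_biUnion, Finset.mem_image, Set.mem_ofPred_eq] at hx
    obtain ⟨⟨y, -, i, -, rfl⟩, h0⟩ := hx
    exact ⟨h0, i, SetLike.coe_mem _⟩
  have hsI : ∀ x ∈ s, x ∈ I := by
    intro x hx
    simp only [s, Finset.mem_filter, Finset.mem_biUnion, Finset.mem_image] at hx
    obtain ⟨⟨y, hy, i, -, rfl⟩, -⟩ := hx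
    exact hIhom i (hG ▸ Submodule.subset_span hy)
  have hIs : I ≤ Ideal.span s := by
    rw [← hG]
    refine Ideal.span_le.2 fun y hy => ?_
    rw [← sum_support_decompose 𝒜 y]
    refine Ideal.sum_mem _ fun i hi => Ideal.subset_span ?_
    simp only [s, Finset.coe_filter, Finset.mem_biUnion, Finset.mem_image, Set.mem_ofPred_eq]
    exact ⟨⟨y, hy, i, hi, rfl⟩, by simpa using hi⟩
  have hsne : s.Nonempty := by
    rw [Finset.nonempty_iff_ne_empty]
    intro h0
    rw [h0] at hIs
    exact hI0 (le_bot_iff.1 (by simpa using hIs))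
  obtain ⟨f, hf, c, hc, hcf⟩ := exists_dvd_forall_of_comparable hP (h _ hP hPhom) s hs hsne
  -- A homogeneous multiplier is needed: for homogeneous elements, lying in `M` and in its core are
  -- equivalent.
  obtain ⟨δ, hδ⟩ := exists_decompose_notMem 𝒜 hc
  apply hδ
  obtain ⟨hf0, β, hfβ⟩ := hs hf
  have hdvd : ∀ z ∈ I, f ∣ (decompose 𝒜 c δ : R) * z := by
    intro z hz
    refine Submodule.span_induction ?_ ?_ ?_ ?_ (hIs hz)
    · intro g hg
      obtain ⟨-, α, hgα⟩ := hs hg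
      exact dvd_decompose_mul 𝒜 hgα hfβ (hcf g hg) δ
    · simp
    · intro x y _ _ hx hy
      rw [mul_add]; exact dvd_add hx hy
    · intro a x _ hx
      rw [smul_eq_mul, mul_left_comm]; exact hx.mul_left a
  refine Ideal.mem_homogeneousCore_of_homogeneous_of_mem ⟨δ, SetLike.coe_mem _⟩ (hJM ?_)
  suffices hmem : algebraMap R (FractionRing R) (decompose 𝒜 c δ) ∈
      (J : FractionalIdeal (nonZeroDivisors R) (FractionRing R)) by
    obtain ⟨z, hz, hzc⟩ := (FractionalIdeal.mem_coeIdeal _).1 hmem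
    exact hinj hzc ▸ hz
  rw [hJ]
  have hf0' : algebraMap R (FractionRing R) f ≠ 0 := by
    rwa [Ne, map_eq_zero_iff _ hinj]
  -- The first factor lies in `I`, and the quotient lies in the inverse of `I` because `f` divides
  -- `c_δ * z` for all `z ∈ I`.
  rw [show algebraMap R (FractionRing R) (decompose 𝒜 c δ) = algebraMap R (FractionRing R) f *
    (algebraMap R (FractionRing R) (decompose 𝒜 c δ) / algebraMap R (FractionRing R) f) by
      field_simp]
  refine FractionalIdeal.mul_mem_mul (FractionalIdeal.mem_coeIdeal_of_mem _ (hsI f hf))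
    ((FractionalIdeal.mem_inv_iff hI0').2 fun y hy => ?_)
  obtain ⟨z, hz, rfl⟩ := (FractionalIdeal.mem_coeIdeal _).1 hy
  obtain ⟨k, hk⟩ := hdvd z hz
  refine (FractionalIdeal.mem_one_iff _).2 ⟨k, ?_⟩
  rw [div_mul_eq_mul_div, ← map_mul, hk, map_mul, mul_div_cancel_left₀ _ hf0']

end Invertible

/-! ### Gradings on subalgebras of the graded quotient field. -/

section Overring

open DirectSum

variable {Γ : Type v} [AddCommMonoid Γ] [DecidableEq Γ]
variable {R : Type u} [CommRing R] [IsDomain R] (𝒜 : Γ → AddSubgroup R) [GradedRing 𝒜]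
variable (T : Subalgebra R (GradedQuotientField 𝒜))

theorem algebraMap_overring_injective : Function.Injective (algebraMap R T) := fun _ _ h =>
  algebraMap_quotientField_injective 𝒜 (congrArg Subtype.val h)

variable [IsCancelAdd Γ]

theorem algebraMap_mem_overringComponent {r : R} {α : Γ} (hr : r ∈ 𝒜 α) :
    algebraMap R T r ∈ overringComponent 𝒜 T (GrothendieckAddGroup.of α) :=
  algebraMap_mem_quotientComponent 𝒜 hr

instance : SetLike.GradedMonoid (overringComponent 𝒜 T) where
  one_mem := by
    have := algebraMap_mem_overringComponent 𝒜 T (SetLike.one_mem_graded 𝒜)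
    rwa [map_one, map_zero] at this
  mul_mem _ _ _ _ hx hy := mul_mem_quotientComponent 𝒜 hx hy

theorem coeAddMonoidHom_overringComponent_injective [DecidableEq (GrothendieckAddGroup Γ)] :
    Function.Injective (DirectSum.coeAddMonoidHom (overringComponent 𝒜 T)) := by
  classical
  rw [injective_iff_map_eq_zero]
  intro x hx
  rw [DirectSum.coeAddMonoidHom_eq_dfinsuppSum, DFinsupp.sum] at hx
  -- A homogeneous common denominator shifts all degrees by `β`, moving the vanishing sum into `R`,
  -- where components are independent.
  obtain ⟨b, hb⟩ := IsLocalization.exist_integer_multiples (nonzeroHomogeneous 𝒜) x.support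
    fun i => ((x i : T) : GradedQuotientField 𝒜)
  choose! r hr using hb
  obtain ⟨hb0, β, hβ⟩ := b.2
  have hsum : ∑ i ∈ x.support, r i = 0 := by
    apply algebraMap_quotientField_injective 𝒜
    have hx' := congrArg T.val hx
    rw [map_sum, map_zero] at hx'
    rw [map_sum, map_zero, Finset.sum_congr rfl hr, ← Finset.smul_sum]
    exact (congrArg _ hx').trans (smul_zero _)
  have hmem := mem_of_sum_mem_of_isHomogeneous 𝒜 x.support
    (fun i => GrothendieckAddGroup.of β + i) (fun i j h => add_left_cancel h) r
    (fun i hi => by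
      rw [hr i hi, Algebra.smul_def]
      exact mul_mem_quotientComponent 𝒜 (algebraMap_mem_quotientComponent 𝒜 hβ) (x i).2)
    (Ideal.IsHomogeneous.bot 𝒜) hsum
  ext i : 2
  by_contra hi
  have hi' : i ∈ x.support := by
    rw [DFinsupp.mem_support_iff]
    exact fun h => hi (congrArg Subtype.val h)
  have h1 := hr i hi'
  rw [(Submodule.mem_bot R).1 (hmem i hi'), map_zero, Algebra.smul_def] at h1
  rcases mul_eq_zero.1 h1.symm with h2 | h2
  · exact hb0 (algebraMap_quotientField_injective 𝒜 (h2.trans (map_zero _).symm))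
  · exact hi (Subtype.ext h2)

/-- A subring of `R_H` containing `R` all of whose elements are sums of homogeneous elements is
graded. -/
@[reducible]
noncomputable def gradedRingOfSurjective [DecidableEq (GrothendieckAddGroup Γ)]
    (hT : Function.Surjective (DirectSum.coeAddMonoidHom (overringComponent 𝒜 T))) :
    GradedRing (overringComponent 𝒜 T) :=
  { (inferInstance : SetLike.GradedMonoid (overringComponent 𝒜 T)),
    DirectSum.IsInternal.chooseDecomposition (overringComponent 𝒜 T)
      ⟨coeAddMonoidHom_overringComponent_injective 𝒜 T, hT⟩ with }

theorem surjective_of_adjoin_homogeneous [DecidableEq (GrothendieckAddGroup Γ)]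
    {u : GradedQuotientField 𝒜} {γ : GrothendieckAddGroup Γ} (hu : u ∈ quotientComponent 𝒜 γ) :
    Function.Surjective
      (DirectSum.coeAddMonoidHom (overringComponent 𝒜 (Algebra.adjoin R {u}))) := by
  classical
  set T := Algebra.adjoin R {u} with hT
  suffices h : ∀ x : T, x ∈ (DirectSum.coeRingHom (overringComponent 𝒜 T)).rangeS from
    fun x => RingHom.mem_rangeS.1 (h x)
  have hmem : ∀ (x : T) (δ), x ∈ overringComponent 𝒜 T δ →
      x ∈ (DirectSum.coeRingHom (overringComponent 𝒜 T)).rangeS := fun x δ hx =>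
    ⟨DirectSum.of (fun δ => overringComponent 𝒜 T δ) δ ⟨x, hx⟩, by simp⟩
  have hR : ∀ r : R, algebraMap R T r ∈ (DirectSum.coeRingHom (overringComponent 𝒜 T)).rangeS := by
    intro r
    rw [← sum_support_decompose 𝒜 r, map_sum]
    exact sum_mem fun i _ => hmem _ _ (algebraMap_mem_overringComponent 𝒜 T (SetLike.coe_mem _))
  rintro ⟨x, hx⟩
  induction hx using Algebra.adjoin_induction with
  | mem x hx => obtain rfl : x = u := hx; exact hmem _ γ hu
  | algebraMap r => exact hR r
  | add x y _ _ h1 h2 => exact add_mem h1 h2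
  | mul x y _ _ h1 h2 => exact mul_mem h1 h2

end Overring

/-! ### From gr-mated to comparability, through the overring `R[f / g]`. -/

section Mated

open DirectSum Polynomial

variable {Γ : Type v} [AddCommMonoid Γ] [DecidableEq Γ] [IsCancelAdd Γ]
variable {R : Type u} [CommRing R] [IsDomain R] (𝒜 : Γ → AddSubgroup R) [GradedRing 𝒜]

theorem isHomogeneous_map_overring [DecidableEq (GrothendieckAddGroup Γ)]
    (T : Subalgebra R (GradedQuotientField 𝒜)) [GradedRing (overringComponent 𝒜 T)]
    {P : Ideal R} (hP : P.IsHomogeneous 𝒜) :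
    (P.map (algebraMap R T)).IsHomogeneous (overringComponent 𝒜 T) := by
  obtain ⟨S, rfl⟩ := (Ideal.IsHomogeneous.iff_exists 𝒜 P).1 hP
  rw [Ideal.map_span]
  apply Ideal.homogeneous_span
  rintro _ ⟨_, ⟨⟨x, α, hx⟩, -, rfl⟩, rfl⟩
  exact ⟨_, algebraMap_mem_overringComponent 𝒜 T hx⟩

theorem comap_constantCoeff_eq {R : Type*} [CommRing R] (P : Ideal R) :
    P.comap (constantCoeff : R[X] →+* R) = P.map C ⊔ Ideal.span {X} := by
  apply le_antisymm
  · intro p hp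
    rw [← p.divX_mul_X_add]
    refine Ideal.add_mem _ (Ideal.mul_mem_left _ _ ?_) (Ideal.mem_sup_left ?_)
    · exact Ideal.mem_sup_right (Ideal.mem_span_singleton_self _)
    · exact Ideal.mem_map_of_mem _ hp
  · refine sup_le (Ideal.map_le_iff_le_comap.2 fun x hx => ?_) ?_
    · simpa using hx
    · simp [Ideal.span_le]

theorem comparable_of_isGrMated [IsIntegrallyClosed R] (h : IsGrMated 𝒜) {P : Ideal R}
    (hP : P.IsPrime) (hPhom : P.IsHomogeneous 𝒜) {f g : R} (hf : f ∈ nonzeroHomogeneous 𝒜)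
    (hg : g ∈ nonzeroHomogeneous 𝒜) : ∃ c ∉ P, f ∣ c * g ∨ g ∣ c * f := by
  classical
  by_contra! hcomp
  obtain ⟨α, hfα⟩ := hf.2
  obtain ⟨β, hgβ⟩ := hg.2
  set u : GradedQuotientField 𝒜 := Localization.mk f ⟨g, hg⟩ with hu
  have hgu : u * algebraMap R _ g = algebraMap R _ f := by
    rw [hu, Localization.mk_eq_mk']
    exact IsLocalization.mk'_spec _ f (⟨g, hg⟩ : nonzeroHomogeneous 𝒜)
  have huγ : u ∈ quotientComponent 𝒜 (GrothendieckAddGroup.of α - GrothendieckAddGroup.of β) :=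
    Or.inr ⟨α, β, f, ⟨g, hg⟩, hfα, hgβ, rfl, rfl⟩
  let K := FractionRing R
  have hinj := IsFractionRing.injective R K
  have hg0 : algebraMap R K g ≠ 0 := by rw [Ne, map_eq_zero_iff _ hinj]; exact hg.1
  let e : GradedQuotientField 𝒜 →ₐ[R] K := IsLocalization.liftAlgHom
    (M := nonzeroHomogeneous 𝒜) (f := Algebra.ofId R K) fun y =>
      (IsUnit.mk0 _ (by
        rw [Ne, Algebra.ofId_apply, map_eq_zero_iff _ hinj]; exact y.2.1))
  have heu : e u * algebraMap R K g = algebraMap R K f := by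
    rw [← e.commutes g, ← map_mul, hgu, e.commutes]
  -- A relation with a coefficient outside `P` would make `f` and `g` comparable at `P`.
  have hrel : ∀ p : R[X], aeval u p = 0 → ∀ i, p.coeff i ∈ P := by
    intro p hp
    by_contra! hi
    have hp' : aeval (e u) p = 0 := by rw [aeval_algHom_apply, hp, map_zero]
    obtain ⟨c, hc, r, hr | hr⟩ := exists_notMem_of_aeval_eq_zero P (e u) _ p le_rfl hp' hi
    · refine (hcomp c hc).2 ⟨r, hinj ?_⟩
      rw [map_mul, map_mul, hr, ← heu]; ring
    · refine (hcomp c hc).1 ⟨r, hinj ?_⟩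
      rw [map_mul, map_mul, hr, ← heu]; ring
  set T := Algebra.adjoin R {u} with hT
  let _ : GradedRing (overringComponent 𝒜 T) :=
    gradedRingOfSurjective 𝒜 T (surjective_of_adjoin_homogeneous 𝒜 huγ)
  let t : T := ⟨u, Algebra.self_mem_adjoin_singleton R u⟩
  have htval : ∀ p : R[X], ((aeval t p : T) : GradedQuotientField 𝒜) = aeval u p := fun p =>
    (aeval_algHom_apply T.val t p).symm
  let φ : R[X] →+* T := (aeval t : R[X] →ₐ[R] T).toRingHom
  have hφC : φ.comp C = algebraMap R T := RingHom.ext fun r => aeval_C t r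
  have hφX : φ X = t := aeval_X t
  have hφ : Function.Surjective φ := by
    rintro ⟨x, hx⟩
    have hx' := hx
    rw [hT, Algebra.adjoin_singleton_eq_range_aeval] at hx'
    obtain ⟨p, rfl⟩ := hx'
    exact ⟨p, Subtype.ext (htval p)⟩
  have hker : RingHom.ker φ ≤ P.map C := fun p hp =>
    Ideal.mem_map_C_iff.2 (hrel p (by rw [← htval p]; exact congrArg Subtype.val hp))
  have hcC : (P.comap (constantCoeff : R[X] →+* R)).comap C = P := by
    ext x; simp
  have hmapC : (P.map C).map φ = P.map (algebraMap R T) := by rw [Ideal.map_map, hφC]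
  have hC2 := comap_constantCoeff_eq P
  have hker2 : RingHom.ker φ ≤ P.comap (constantCoeff : R[X] →+* R) :=
    hker.trans (hC2 ▸ le_sup_left)
  have hprime1 : (P.map C : Ideal R[X]).IsPrime := Ideal.isPrime_map_C_of_isPrime
  have hQ1 : (P.map (algebraMap R T)).IsPrime := by
    rw [← hmapC]; exact Ideal.map_isPrime_of_surjective hφ hker
  have hQ2 : ((P.comap (constantCoeff : R[X] →+* R)).map φ).IsPrime :=
    Ideal.map_isPrime_of_surjective hφ hker2
  have hcomap : ∀ J : Ideal R[X], RingHom.ker φ ≤ J →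
      (J.map φ).comap φ = J := fun J hJ => by
    rw [Ideal.comap_map_of_surjective' φ hφ, sup_eq_left.2 hJ]
  have hhom2 : ((P.comap (constantCoeff : R[X] →+* R)).map φ).IsHomogeneous
      (overringComponent 𝒜 T) := by
    rw [hC2, Ideal.map_sup, hmapC, Ideal.map_span, Set.image_singleton, hφX]
    refine (isHomogeneous_map_overring 𝒜 T hPhom).sup (Ideal.homogeneous_span _ _ ?_)
    rintro _ rfl
    exact ⟨_, huγ⟩
  -- The ideals `PT` and `PT + uT` are the images of `P[X]` and `P[X] + (X)`; their equality would
  -- put `X` in `P[X]`.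
  have huniq := (h T P hP hPhom hQ1.ne_top).unique
    (y₁ := P.map (algebraMap R T)) (y₂ := (P.comap (constantCoeff : R[X] →+* R)).map φ)
    ⟨hQ1, isHomogeneous_map_overring 𝒜 T hPhom, ?_⟩ ⟨hQ2, hhom2, ?_⟩
  · have h1 := congrArg (Ideal.comap φ) huniq
    rw [← hmapC, hcomap _ hker, hcomap _ hker2] at h1
    have hX : (X : R[X]) ∈ P.map (C : R →+* R[X]) := by rw [h1]; simp
    have h2 := Ideal.mem_map_C_iff.1 hX 1
    rw [coeff_X_one] at h2
    exact hP.one_notMem h2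
  · rw [← hmapC, ← hφC, ← Ideal.comap_comap, hcomap _ hker]
    ext x
    refine ⟨fun hx => ?_, fun hx => Ideal.mem_map_of_mem _ hx⟩
    have := Ideal.mem_map_C_iff.1 hx 0
    rwa [coeff_C_zero] at this
  · rw [← hφC, ← Ideal.comap_comap, hcomap _ hker2, hcC]

end Mated

/-! ### From comparability to gr-mated, through denominators outside `P`. -/

section Prufer

open DirectSum

variable {Γ : Type v} [AddCommMonoid Γ] [DecidableEq Γ] [IsCancelAdd Γ]
variable {R : Type u} [CommRing R] [IsDomain R] (𝒜 : Γ → AddSubgroup R) [GradedRing 𝒜]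

theorem exists_denominator_of_homogeneous
    (hcomp : ∀ P : Ideal R, P.IsPrime → ∀ f ∈ nonzeroHomogeneous 𝒜,
      ∀ g ∈ nonzeroHomogeneous 𝒜, ∃ c ∉ P, f ∣ c * g ∨ g ∣ c * f)
    (T : Subalgebra R (GradedQuotientField 𝒜)) {M : Ideal T} (hM : M.IsPrime) {x : T}
    {γ : GrothendieckAddGroup Γ} (hx : x ∈ overringComponent 𝒜 T γ) :
    ∃ s : R, SetLike.IsHomogeneousElem 𝒜 s ∧ algebraMap R T s ∉ M ∧
      ∃ r, algebraMap R T r = algebraMap R T s * x := by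
  by_cases hx0 : x = 0
  · exact ⟨1, SetLike.isHomogeneousElem_one 𝒜, by rw [map_one]; exact hM.one_notMem, 0,
      by rw [hx0, map_zero, mul_zero]⟩
  obtain h0 | ⟨α, β, f, g, hf, hg, -, hxfg⟩ := hx
  · exact (hx0 (Subtype.ext h0)).elim
  have hgx : algebraMap R T g * x = algebraMap R T f := by
    apply Subtype.ext
    change algebraMap R (GradedQuotientField 𝒜) g * (T.val x) = algebraMap R _ f
    change T.val x = _ at hxfg
    rw [hxfg, Localization.mk_eq_mk', IsLocalization.mk'_spec']
  have hg0 : algebraMap R T g ≠ 0 := by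
    rw [Ne, map_eq_zero_iff _ (algebraMap_overring_injective 𝒜 T)]
    exact g.2.1
  have hf0 : f ≠ 0 := by
    rintro rfl
    rw [map_zero] at hgx
    exact (mul_ne_zero hg0 hx0) hgx
  have hs : ∃ s : R, algebraMap R T s ∉ M ∧ ∃ r, algebraMap R T r = algebraMap R T s * x := by
    obtain ⟨c, hc, ⟨r, hr⟩ | ⟨r, hr⟩⟩ := hcomp (M.comap (algebraMap R T)) (hM.comap _) f
      ⟨hf0, α, hf⟩ g g.2
    -- Here `r` is the denominator: `c = r x` in `T`, so `r ∈ M` would force `c ∈ M`.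
    · have hcr : algebraMap R T c = algebraMap R T r * x := by
        apply mul_left_cancel₀ hg0
        rw [← map_mul, mul_comm, hr, map_mul, ← hgx]
        ring
      refine ⟨r, fun hrM => hc ?_, c, hcr⟩
      rw [Ideal.mem_comap, hcr]
      exact M.mul_mem_right _ hrM
    · refine ⟨c, hc, r, mul_left_cancel₀ hg0 ?_⟩
      rw [mul_left_comm, hgx, ← map_mul, ← map_mul, hr]
  obtain ⟨s, hs, r, hr⟩ := hs
  have hdvd : (g : R) ∣ s * f := by
    refine ⟨r, algebraMap_overring_injective 𝒜 T ?_⟩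
    rw [map_mul, map_mul, hr, ← hgx]
    ring
  obtain ⟨δ, hδ⟩ := exists_decompose_notMem 𝒜 (P := M.comap (algebraMap R T)) hs
  obtain ⟨r', hr'⟩ := dvd_decompose_mul 𝒜 hf hg hdvd δ
  refine ⟨_, ⟨δ, SetLike.coe_mem _⟩, hδ, r', mul_left_cancel₀ hg0 ?_⟩
  rw [mul_left_comm, hgx, ← map_mul, ← map_mul, hr']

theorem isGrMated_of_comparable
    (hcomp : ∀ P : Ideal R, P.IsPrime → ∀ f ∈ nonzeroHomogeneous 𝒜,
      ∀ g ∈ nonzeroHomogeneous 𝒜, ∃ c ∉ P, f ∣ c * g ∨ g ∣ c * f) :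
    IsGrMated 𝒜 := by
  classical
  intro T _ P hP hPhom hPT
  have hinj := algebraMap_overring_injective 𝒜 T
  obtain ⟨M, hM, hPM⟩ := Ideal.exists_le_maximal _ hPT
  rw [Ideal.map_le_iff_le_comap] at hPM
  -- One homogeneous `s` clears every component of `x`, so membership of `x` in `Q` can be tested
  -- degree by degree.
  have hcommon : ∀ x : T, ∃ s ∉ P, SetLike.IsHomogeneousElem 𝒜 s ∧
      ∀ i ∈ (decompose (overringComponent 𝒜 T) x).support,
      ∃ r, algebraMap R T r =
        algebraMap R T s * (decompose (overringComponent 𝒜 T) x i : T) := by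
    intro x
    choose s hhom hs r hr using fun i => exists_denominator_of_homogeneous 𝒜 hcomp T hM.isPrime
      (SetLike.coe_mem (decompose (overringComponent 𝒜 T) x i))
    refine ⟨∏ i ∈ (decompose (overringComponent 𝒜 T) x).support, s i, ?_,
      (SetLike.homogeneousSubmonoid 𝒜).prod_mem fun i _ => hhom i, fun i hi =>
      ⟨(∏ j ∈ (decompose (overringComponent 𝒜 T) x).support.erase i, s j) * r i, ?_⟩⟩
    · rw [hP.prod_mem_iff]
      rintro ⟨i, -, hi⟩
      exact hs i (hPM hi)
    · rw [map_mul, hr, ← mul_assoc, ← map_mul, Finset.prod_erase_mul _ _ hi]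
  have hden : ∀ x : T, ∃ s ∉ P, ∃ r, algebraMap R T r = algebraMap R T s * x := by
    intro x
    obtain ⟨s, hs, -, h⟩ := hcommon x
    choose! r hr using h
    refine ⟨s, hs, ∑ i ∈ (decompose (overringComponent 𝒜 T) x).support, r i, ?_⟩
    rw [map_sum, Finset.sum_congr rfl hr, ← Finset.mul_sum, sum_support_decompose]
  -- This is `P R_P ∩ T`, written without localizing.
  let Q : Ideal T :=
    { carrier := {x | ∃ s ∉ P, ∃ p ∈ P, algebraMap R T p = algebraMap R T s * x}
      zero_mem' := ⟨1, hP.one_notMem, 0, P.zero_mem, by simp⟩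
      add_mem' := by
        rintro x y ⟨s, hs, p, hp, hx⟩ ⟨t, ht, q, hq, hy⟩
        refine ⟨s * t, hP.mul_notMem hs ht, t * p + s * q,
          P.add_mem (P.mul_mem_left _ hp) (P.mul_mem_left _ hq), ?_⟩
        rw [map_add, map_mul, map_mul, hx, hy, map_mul]
        ring
      smul_mem' := by
        rintro y x ⟨s, hs, p, hp, hx⟩
        obtain ⟨t, ht, r, hr⟩ := hden y
        refine ⟨s * t, hP.mul_notMem hs ht, r * p, P.mul_mem_left _ hp, ?_⟩
        rw [map_mul, hx, hr, map_mul, smul_eq_mul]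
        ring }
  have hQmem : ∀ x, x ∈ Q ↔ ∃ s ∉ P, ∃ p ∈ P, algebraMap R T p = algebraMap R T s * x :=
    fun _ => Iff.rfl
  have hQcomap : Q.comap (algebraMap R T) = P := by
    ext x
    rw [Ideal.mem_comap, hQmem]
    constructor
    · rintro ⟨s, hs, p, hp, hx⟩
      rw [← map_mul] at hx
      rw [hinj hx] at hp
      exact (hP.mem_or_mem hp).resolve_left hs
    · exact fun hx => ⟨1, hP.one_notMem, x, hx, by simp⟩
  have hQden : ∀ {x : T} {s r : R}, s ∉ P → algebraMap R T r = algebraMap R T s * x →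
      (x ∈ Q ↔ r ∈ P) := by
    intro x s r hs hr
    refine ⟨fun hx => ?_, fun hx => ⟨s, hs, r, hx, hr⟩⟩
    rw [← hQcomap, Ideal.mem_comap, hr]
    exact Q.mul_mem_left _ hx
  refine ⟨Q, ⟨⟨?_, ?_⟩, ?_, hQcomap⟩, ?_⟩
  · rintro h
    rw [h, Ideal.comap_top] at hQcomap
    exact hP.ne_top hQcomap.symm
  · intro x y hxy
    obtain ⟨s, hs, r, hr⟩ := hden x
    obtain ⟨t, ht, q, hq⟩ := hden y
    rw [hQden hs hr, hQden ht hq]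
    refine hP.mem_or_mem ((hQden (hP.mul_notMem hs ht) ?_).1 hxy)
    rw [map_mul, map_mul, hr, hq]
    ring
  · intro i x hx
    obtain ⟨s, hs, ⟨δ, hδ⟩, h⟩ := hcommon x
    choose! r hr using h
    by_cases hi : i ∈ (decompose (overringComponent 𝒜 T) x).support
    swap
    · rw [DFinsupp.notMem_support_iff.1 hi]; exact Q.zero_mem
    refine (hQden hs (hr i hi)).2 (mem_of_sum_mem_of_isHomogeneous 𝒜
      (decompose (overringComponent 𝒜 T) x).support (fun i => GrothendieckAddGroup.of δ + i)
      (fun _ _ h => add_left_cancel h) r (fun j hj => ?_) hPhom ((hQden hs ?_).1 hx) i hi)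
    · have := SetLike.mul_mem_graded (algebraMap_mem_overringComponent 𝒜 T hδ)
        (SetLike.coe_mem (decompose (overringComponent 𝒜 T) x j))
      rw [← hr j hj] at this
      exact this
    · rw [map_sum, Finset.sum_congr rfl hr, ← Finset.mul_sum, sum_support_decompose]
  · rintro Q' ⟨hQ', -, hQ'P⟩
    ext x
    obtain ⟨s, hs, r, hr⟩ := hden x
    rw [hQden hs hr, ← hQ'P, Ideal.mem_comap, hr]
    refine ⟨fun h => Q'.mul_mem_left _ h, fun h => (hQ'.mem_or_mem h).resolve_left fun h' => ?_⟩
    exact hs (hQ'P ▸ h')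

end Prufer

end GradedDomain

theorem mainTheorem2 {Γ : Type*} [AddCommMonoid Γ] [IsCancelAdd Γ] [IsAddTorsionFree Γ]
    [DecidableEq Γ] {R : Type*} [CommRing R] [IsDomain R] [IsIntegrallyClosed R]
    (𝒜 : Γ → AddSubgroup R) [GradedRing 𝒜] :
    GradedDomain.IsGrPrufer 𝒜 ↔ GradedDomain.IsGrMated 𝒜 := by
  refine ⟨fun h => GradedDomain.isGrMated_of_comparable 𝒜 fun P hP f hf g hg => ?_,
    fun h => GradedDomain.isGrPrufer_of_comparable 𝒜 fun P hP hPhom f hf g hg =>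
      GradedDomain.comparable_of_isGrMated 𝒜 h hP hPhom hf hg⟩
  refine GradedDomain.exists_notMem_dvd_of_isUnit_span_pair (h _ ?_ ?_ ?_) hf.1 hP
  · exact fun h0 => hf.1 ((Submodule.eq_bot_iff _).1 h0 f (Ideal.subset_span (by simp)))
  · exact Submodule.fg_span (Set.toFinite _)
  · apply Ideal.homogeneous_span
    rintro x (rfl | rfl)
    exacts [hf.2, hg.2]
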